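/- Let $k$ be a field and let $D$ be a division algebra that is finite-dimensional over its center $F=Z(D)=k((t))$. Let $w$ be the unique extension to $D$ of the $t$-adic valuation of $F$, with valuation ring $V_D$, maximal ideal $M_D$ and residue division ring $\bar D=V_D/M_D$; let $\bar F$ be the residue field of $F$, viewed inside the center $Z(\bar D)$. Suppose that $D$ is splittable, i.e. the residue homomorphism $V_D\to\bar D$ has a section that is a ring homomorphism, and fix such a section $u:\bar D\hookrightarrow V_D$. A parameter of $D$ is an element $z$ with $w(z)>0$ whose value generates the value group of $D$. For a parameter $z$, $m\in\mathbb Z$ and $i\ge 1$, the map ${}^{(z,u)}_m\delta_i:\bar D\to\bar D$ is defined by the (unique, convergent) expansions $$z^m u(a) z^{-m}=u(\alpha^m(a))+u({}^{(z,u)}_m\delta_1(a))\,z+u({}^{(z,u)}_m\delta_2(a))\,z^2+\cdots\qquad(a\in\bar D),$$ where $\alpha$ is the automorphism of $\bar D$ induced by conjugation by $z$. Let $n=|\mathrm{Gal}(Z(\bar D)/\bar F)|$ be the number of automorphisms of $Z(\bar D)$ over $\bar F$. Then there is a parameter $z'$ of $D$ such that $${}^{(z',u)}_m\delta_j=0\quad\text{for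 all } m\in\mathbb Z \text{ and all } j\ge 1 \text{ with } n\nmid j .$$ -/

import Mathlib

namespace DeltaMaps

section

variable {D : Type*} [DivisionRing D] {Γ₀ : Type*} [LinearOrderedCommGroupWithZero Γ₀]
  (w : Valuation D Γ₀)

/-- The maximal ideal `M_D = {x | w x < 1}` (multiplicative notation) of the valuation ring
`V_D = {x | w x ≤ 1} = w.integer`. -/
def maxIdeal : Ideal w.integer where
  carrier := {x | w (x : D) < 1}
  zero_mem' := by simp
  add_mem' {x y} hx hy := by
    simpa using lt_of_le_of_lt (w.map_add (x : D) y) (max_lt hx hy)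
  smul_mem' c x hx := by
    have hc : w (c : D) ≤ 1 := c.2
    simpa using lt_of_le_of_lt (mul_le_of_le_one_left' hc) hx

instance maxIdeal_isTwoSided : (maxIdeal w).IsTwoSided where
  mul_mem_of_left {a} b ha := by
    have hb : w (b : D) ≤ 1 := b.2
    have h : w (a : D) * w (b : D) < 1 := lt_of_le_of_lt (mul_le_of_le_one_right' hb) ha
    simpa [maxIdeal] using h

/-- The residue division ring `V_D / M_D`. -/
abbrev Residue : Type _ := w.integer ⧸ maxIdeal w

/-- The residue homomorphism `V_D → V_D / M_D`. -/
def residue : w.integer →+* Residue w := Ideal.Quotient.mk (maxIdeal w)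

/-- The residue field of the center `Z(D)`, that is, the image of `V_D ∩ Z(D)` in `V_D / M_D`,
as a subring of the center of the residue division ring. -/
def residueOfCenter : Subring (Subring.center (Residue w)) :=
  (((Subring.center D).comap w.integer.subtype).map (residue w)).comap
    (Subring.center (Residue w)).subtype

/-- The order of the Galois group (the group of all automorphisms) of the center of the
residue division ring over the residue field of `Z(D)`. -/
noncomputable def galOrder : ℕ :=
  Nat.card (Subring.center (Residue w) ≃ₐ[residueOfCenter w] Subring.center (Residue w))

/-- An embedding of the residue division ring into `V_D` that is a section of the residue
homomorphism. The division algebra `D` is splittable iff such a section exists. -/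
structure ResidueSection where
  toHom : Residue w →+* w.integer
  residue_toHom : ∀ a, residue w (toHom a) = a

/-- `z` is a parameter of `D`: it has positive value (`w z < 1` in multiplicative notation)
and its value generates the value group of `D`. -/
structure IsParameter (z : D) : Prop where
  ne_zero : z ≠ 0
  lt_one : w z < 1
  generates : ∀ x : D, x ≠ 0 → ∃ i : ℤ, w x = w z ^ i

variable {w}

theorem residue_eq_zero_iff (x : w.integer) : residue w x = 0 ↔ w (x : D) < 1 :=
  Ideal.Quotient.eq_zero_iff_mem

theorem IsParameter.le_of_lt_one {z : D} (hz : IsParameter w z) {x : D} (hx : w x < 1) :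
    w x ≤ w z := by
  by_cases h0 : x = 0
  · simp [h0]
  · obtain ⟨i, hi⟩ := hz.generates x h0
    have hz0 : 0 < w z := zero_lt_iff.mpr (w.ne_zero_iff.mpr hz.ne_zero)
    have hi1 : 1 ≤ i := by
      by_contra hcon
      have : (1 : Γ₀) ≤ w z ^ i := one_le_zpow_of_nonpos₀ hz0 hz.lt_one.le (by omega)
      rw [← hi] at this
      exact absurd hx (not_lt.mpr this)
    rw [hi]
    simpa using zpow_le_zpow_right_of_le_one₀ hz0 hz.lt_one.le hi1

theorem IsParameter.tail_mem {z : D} (hz : IsParameter w z) (u : ResidueSection w)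
    (x : w.integer) :
    ((x : D) - (u.toHom (residue w x) : D)) * z⁻¹ ∈ w.integer := by
  have h : w (((x - u.toHom (residue w x) : w.integer)) : D) < 1 := by
    rw [← residue_eq_zero_iff, map_sub, u.residue_toHom, sub_self]
  have h2 := hz.le_of_lt_one h
  have hz0 : 0 < w z := zero_lt_iff.mpr (w.ne_zero_iff.mpr hz.ne_zero)
  change w _ ≤ 1
  rw [map_mul, map_inv₀]
  exact mul_inv_le_one_of_le₀ h2 hz0.le

/-- If `x = u(c₀) + u(c₁) z + u(c₂) z² + ⋯`, then `tail x = u(c₁) + u(c₂) z + ⋯`. -/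
def tail {z : D} (hz : IsParameter w z) (u : ResidueSection w) (x : w.integer) : w.integer :=
  ⟨((x : D) - (u.toHom (residue w x) : D)) * z⁻¹, hz.tail_mem u x⟩

/-- The coefficient `c_i` of `x ∈ V_D` in its expansion `x = u(c₀) + u(c₁) z + u(c₂) z² + ⋯`. -/
def coeff {z : D} (hz : IsParameter w z) (u : ResidueSection w) (i : ℕ) (x : w.integer) :
    Residue w :=
  residue w ((tail hz u)^[i] x)

theorem expansion {z : D} (hz : IsParameter w z) (u : ResidueSection w) (x : w.integer) (N : ℕ) :
    (x : D) = ∑ i ∈ Finset.range N, (u.toHom (coeff hz u i x) : D) * z ^ i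
      + ((tail hz u)^[N] x : D) * z ^ N := by
  induction N with
  | zero => simp
  | succ N ih =>
    have h : ((tail hz u)^[N] x : D)
        = (u.toHom (coeff hz u N x) : D) + ((tail hz u)^[N + 1] x : D) * z := by
      rw [Function.iterate_succ_apply']
      simp [tail, coeff, hz.ne_zero]
    rw [Finset.sum_range_succ, add_assoc, pow_succ' z N, ← mul_assoc, ← add_mul, ← h]
    exact ih

/-- The series `∑ u(c_i) z^i` with `c_i = coeff i x` converges to `x`. -/
theorem expansion_error_le {z : D} (hz : IsParameter w z) (u : ResidueSection w)
    (x : w.integer) (N : ℕ) :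
    w ((x : D) - ∑ i ∈ Finset.range N, (u.toHom (coeff hz u i x) : D) * z ^ i) ≤ w z ^ N := by
  have h := expansion hz u x N
  rw [← sub_eq_iff_eq_add'] at h
  rw [h, map_mul, map_pow]
  exact mul_le_of_le_one_left' ((tail hz u)^[N] x).2

/-- The coefficients are uniquely determined by convergence of the series to `x`. -/
theorem coeff_unique {z : D} (hz : IsParameter w z) (u : ResidueSection w)
    (x : w.integer) (c : ℕ → Residue w)
    (hc : ∀ N, w ((x : D) - ∑ i ∈ Finset.range N, (u.toHom (c i) : D) * z ^ i) ≤ w z ^ N)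
    (i : ℕ) : coeff hz u i x = c i := by
  have hz0 : 0 < w z := zero_lt_iff.mpr (w.ne_zero_iff.mpr hz.ne_zero)
  induction i generalizing x c with
  | zero =>
    have h1 := hc 1
    simp only [Finset.range_one, Finset.sum_singleton, pow_zero, mul_one, pow_one] at h1
    have h2 : residue w (x - u.toHom (c 0)) = 0 :=
      (residue_eq_zero_iff _).mpr (lt_of_le_of_lt h1 hz.lt_one)
    rw [map_sub, u.residue_toHom, sub_eq_zero] at h2
    exact h2
  | succ i ih =>
    have h0 : residue w x = c 0 := by
      have h1 := hc 1
      simp only [Finset.range_one, Finset.sum_singleton, pow_zero, mul_one, pow_one] at h1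
      have h2 : residue w (x - u.toHom (c 0)) = 0 :=
        (residue_eq_zero_iff _).mpr (lt_of_le_of_lt h1 hz.lt_one)
      rw [map_sub, u.residue_toHom, sub_eq_zero] at h2
      exact h2
    have key := ih (tail hz u x) (fun i => c (i + 1)) (fun N => ?_)
    · simpa [coeff] using key
    · have h := hc (N + 1)
      rw [Finset.sum_range_succ'] at h
      have e : (x : D) - (∑ i ∈ Finset.range N, (u.toHom (c (i + 1)) : D) * z ^ (i + 1)
          + (u.toHom (c 0) : D) * z ^ 0)
          = ((tail hz u x : D) - ∑ i ∈ Finset.range N, (u.toHom (c (i + 1)) : D) * z ^ i) * z := by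
        rw [sub_mul, Finset.sum_mul]
        simp only [tail, h0, mul_assoc, inv_mul_cancel₀ hz.ne_zero, mul_one, pow_succ, pow_zero]
        abel
      rw [e, map_mul, pow_succ] at h
      exact le_of_mul_le_mul_right h hz0

theorem conj_mem {z : D} (hz : IsParameter w z) (m : ℤ) (x : w.integer) :
    z ^ m * (x : D) * z ^ (-m) ∈ w.integer := by
  have h0 : w z ^ m ≠ 0 := zpow_ne_zero _ (w.ne_zero_iff.mpr hz.ne_zero)
  have hx : w (x : D) ≤ 1 := x.2
  change w _ ≤ 1
  rw [map_mul, map_mul, map_zpow₀, map_zpow₀, zpow_neg, mul_comm (w z ^ m), mul_assoc,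
    mul_inv_cancel₀ h0, mul_one]
  exact hx

/-- The element `z^m u(a) z^{-m}` of `V_D`. -/
def conj {z : D} (hz : IsParameter w z) (u : ResidueSection w) (m : ℤ) (a : Residue w) :
    w.integer :=
  ⟨z ^ m * (u.toHom a : D) * z ^ (-m), conj_mem hz m (u.toHom a)⟩

/-- The map `_mδ_i` relative to `(z, u)`, for `m ∈ ℤ` and `i ≥ 1`, determined by
`z^m u(a) z^{-m} = u(α^m(a)) + u(_mδ_1(a)) z + u(_mδ_2(a)) z² + ⋯`.
For `i = 0` the formula gives `α^m`. -/
def deltaMap {z : D} (hz : IsParameter w z) (u : ResidueSection w) (m : ℤ) (i : ℕ) :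
    Residue w → Residue w :=
  fun a => coeff hz u i (conj hz u m a)

/-- For `m = 0` the maps `_0δ_i`, `i ≥ 1`, vanish. -/
theorem deltaMap_zero_left {z : D} (hz : IsParameter w z) (u : ResidueSection w) {i : ℕ}
    (hi : 1 ≤ i) : deltaMap hz u 0 i = 0 := by
  funext a
  have h := coeff_unique hz u (conj hz u 0 a) (fun i => if i = 0 then a else 0) (fun N => ?_) i
  · simpa [deltaMap, show i ≠ 0 by omega] using h
  · cases N with
    | zero =>
      have h : w (conj hz u 0 a : D) ≤ 1 := (conj hz u 0 a).2
      simpa only [Finset.range_zero, Finset.sum_empty, sub_zero, pow_zero] using h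
    | succ N => simp [Finset.sum_range_succ', conj]

end

end DeltaMaps

/-! Let `L` be the separable closure of `k` in `Z(D̄)`, `θ` a generator of `L` over `k`, and `α` the
automorphism of `Z(D̄)` induced by a parameter. The section `u` need not be `k`-linear, so `u(L)` is
replaced by a `k`-linear lift `s : L → V_D`: Hensel's lemma moves `u(θ)` to a root of the minimal
polynomial of `θ`, which still commutes with all of `u(D̄)` (`exists_lift`). Multiplying a parameter
by a suitable unit gives `z` with `z s(l) z⁻¹ = s(α l)` (`exists_parameter_unitConj_lift`).

Every `z^m u(a) z^{-m}` then commutes with `s(L) = z^m s(L) z^{-m}`. If `∑ u(c_j) z^j` commutes with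
`s(θ)`, comparing leading terms yields `c_j (α^j θ - θ) = 0`, so `c_j = 0` unless `α^j` fixes `θ`
(`coeff_eq_zero_of_commute`). An automorphism of `Z(D̄)` over `k` is determined by its value at `θ`,
and `α` generates the group of these automorphisms by an argument of Skolem–Noether type
(`mem_zpowers_centerAut`), so `α^j = 1` means `n ∣ j`. -/

namespace DeltaMaps

open PowerSeries Polynomial

/-! ### The valuation ring as an algebra over `k⟦X⟧`. -/

section

variable {k : Type*} [Field k] {D : Type*} [Ring D] [Algebra (LaurentSeries k) D]
  {Γ₀ : Type*} [LinearOrderedCommGroupWithZero Γ₀] (w : Valuation D Γ₀)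
  [Valuation.HasExtension (Valued.v : Valuation (LaurentSeries k) (WithZero (Multiplicative ℤ))) w]

theorem algebraMap_mem_integer_iff (y : LaurentSeries k) :
    algebraMap (LaurentSeries k) D y ∈ w.integer ↔ ∃ f : k⟦X⟧, (f : LaurentSeries k) = y := by
  rw [← LaurentSeries.val_le_one_iff_eq_coe]
  exact Valuation.HasExtension.val_map_le_one_iff Valued.v w y

/-- The valuation ring is an algebra over the power series ring. -/
noncomputable instance powerSeriesAlgebra : Algebra k⟦X⟧ w.integer :=
  RingHom.toAlgebra'
    (((algebraMap (LaurentSeries k) D).comp (algebraMap k⟦X⟧ (LaurentSeries k))).codRestrict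
      w.integer fun f => (algebraMap_mem_integer_iff w _).2 ⟨f, rfl⟩)
    fun _ _ => Subtype.ext (Algebra.commutes _ _)

theorem coe_algebraMap_powerSeries (f : k⟦X⟧) :
    (algebraMap k⟦X⟧ w.integer f : D) = algebraMap (LaurentSeries k) D (f : LaurentSeries k) :=
  rfl

/-- The valuation ring is an algebra over the field of coefficients. -/
noncomputable instance coefficientAlgebra : Algebra k w.integer :=
  RingHom.toAlgebra' ((algebraMap k⟦X⟧ w.integer).comp (PowerSeries.C (R := k)))
    fun c x => Algebra.commutes (PowerSeries.C c : k⟦X⟧) x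

theorem algebraMap_coefficient (c : k) :
    algebraMap k w.integer c = algebraMap k⟦X⟧ w.integer (PowerSeries.C c) :=
  rfl

/-- The uniformizer of the center, as an element of the valuation ring. -/
noncomputable def uniformizer (k : Type*) [Field k] [Algebra (LaurentSeries k) D]
    [Valuation.HasExtension
      (Valued.v : Valuation (LaurentSeries k) (WithZero (Multiplicative ℤ))) w] : w.integer :=
  algebraMap k⟦X⟧ w.integer PowerSeries.X

theorem coe_uniformizer : (uniformizer w k : D)
    = algebraMap (LaurentSeries k) D (HahnSeries.single 1 1) := by
  rw [uniformizer, coe_algebraMap_powerSeries, PowerSeries.coe_X]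

theorem val_uniformizer_lt_one : w (uniformizer w k : D) < 1 := by
  rw [coe_uniformizer, Valuation.HasExtension.val_map_lt_one_iff
    (Valued.v : Valuation (LaurentSeries k) (WithZero (Multiplicative ℤ))),
    LaurentSeries.valuation_single_zpow, ← WithZero.exp_zero]
  exact WithZero.exp_lt_exp.2 (by norm_num)

theorem val_uniformizer_ne_zero : w (uniformizer w k : D) ≠ 0 := by
  rw [coe_uniformizer, ← map_zero w, ← map_zero (algebraMap (LaurentSeries k) D), Ne,
    Valuation.HasExtension.val_map_eq_iff
    (Valued.v : Valuation (LaurentSeries k) (WithZero (Multiplicative ℤ))), map_zero,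
    LaurentSeries.valuation_single_zpow]
  exact WithZero.exp_ne_zero

theorem val_algebraMap_eq_zpow {y : LaurentSeries k} (hy : y ≠ 0) :
    ∃ j : ℤ, w (algebraMap (LaurentSeries k) D y) = w (uniformizer w k : D) ^ j := by
  obtain ⟨j, hj⟩ : ∃ j : ℤ, Valued.v y = WithZero.exp j :=
    ⟨_, (WithZero.exp_log ((Valuation.ne_zero_iff _).2 hy)).symm⟩
  have key : ∀ j : ℤ, w (algebraMap (LaurentSeries k) D (HahnSeries.single j 1))
      = w (uniformizer w k : D) ^ j := by
    intro j
    rw [coe_uniformizer]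
    change (w.comap (algebraMap (LaurentSeries k) D)) _
      = (w.comap (algebraMap (LaurentSeries k) D)) _ ^ j
    rw [← map_zpow₀, RatFunc.single_zpow]
  refine ⟨-j, ?_⟩
  rw [← key, Valuation.HasExtension.val_map_eq_iff
    (Valued.v : Valuation (LaurentSeries k) (WithZero (Multiplicative ℤ))),
    LaurentSeries.valuation_single_zpow, hj, neg_neg]

end

/-! ### Discreteness of the value group and existence of a parameter. -/

section

variable {k : Type*} [Field k] {D : Type*} [DivisionRing D] [Algebra (LaurentSeries k) D]
  {Γ₀ : Type*} [LinearOrderedCommGroupWithZero Γ₀] (w : Valuation D Γ₀)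
  [Valuation.HasExtension (Valued.v : Valuation (LaurentSeries k) (WithZero (Multiplicative ℤ))) w]

/-- Some positive power, with exponent at most the dimension, of each nonzero value is a value of
the center. -/
theorem exists_val_pow_eq [FiniteDimensional (LaurentSeries k) D] {x : D} (hx : x ≠ 0) :
    ∃ e : ℕ, 0 < e ∧ e ≤ Module.finrank (LaurentSeries k) D ∧
      ∃ j : ℤ, w x ^ e = w (uniformizer w k : D) ^ j := by
  classical
  set p := minpoly (LaurentSeries k) x with hp
  have hp0 : p ≠ 0 := minpoly.ne_zero (Algebra.IsIntegral.isIntegral x)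
  have hsum : ∑ i ∈ p.support, algebraMap (LaurentSeries k) D (p.coeff i) * x ^ i = 0 := by
    have := minpoly.aeval (LaurentSeries k) x
    rwa [aeval_eq_sum_range, ← hp, ← Polynomial.sum_over_range (p := p)
      (f := fun i a => a • x ^ i) (by simp), Polynomial.sum_def,
      Finset.sum_congr rfl fun i _ => Algebra.smul_def _ _] at this
  set f : ℕ → D := fun i => algebraMap (LaurentSeries k) D (p.coeff i) * x ^ i with hf
  have hf0 : ∀ i ∈ p.support, f i ≠ 0 := fun i hi => mul_ne_zero
    ((map_ne_zero_iff _ (algebraMap (LaurentSeries k) D).injective).2 (mem_support_iff.1 hi))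
    (pow_ne_zero _ hx)
  obtain ⟨i, hi, hmax⟩ := Finset.exists_max_image p.support (fun i => w (f i))
    (nonempty_support_iff.2 hp0)
  -- The terms of the minimal equation sum to zero, so the maximal value is attained at least twice;
  -- the ratio of two such terms gives the required power of `x`.
  obtain ⟨i', hi', hne, heq⟩ : ∃ i' ∈ p.support, i' ≠ i ∧ w (f i') = w (f i) := by
    by_contra! hcon
    have := w.map_sum_eq_of_lt hi (f := f) fun i' hi' => by
      rw [Finset.mem_sdiff, Finset.mem_singleton] at hi'
      exact lt_of_le_of_ne (hmax i' hi'.1) (hcon i' hi'.1 hi'.2)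
    rw [hsum, map_zero] at this
    exact w.ne_zero_iff.2 (hf0 i hi) this.symm
  have key : ∀ i ∈ p.support, ∀ i' ∈ p.support, i < i' → w (f i') = w (f i) →
      ∃ e : ℕ, 0 < e ∧ e ≤ Module.finrank (LaurentSeries k) D ∧
      ∃ j : ℤ, w x ^ e = w (uniformizer w k : D) ^ j := by
    intro i hi i' hi' hlt heq
    refine ⟨i' - i, by omega, ?_, ?_⟩
    · exact (Nat.sub_le _ _).trans ((le_natDegree_of_mem_supp _ hi').trans (minpoly.natDegree_le x))
    · obtain ⟨a, ha⟩ := val_algebraMap_eq_zpow w (mem_support_iff.1 hi)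
      obtain ⟨b, hb⟩ := val_algebraMap_eq_zpow w (mem_support_iff.1 hi')
      refine ⟨a - b, ?_⟩
      have ht := val_uniformizer_ne_zero (k := k) w
      have hx' := w.ne_zero_iff.2 hx
      simp only [hf, map_mul, map_pow, ha, hb] at heq
      rw [zpow_sub₀ ht, eq_div_iff (zpow_ne_zero _ ht), ← mul_right_inj' (pow_ne_zero i hx'),
        ← mul_assoc, ← pow_add, Nat.add_sub_cancel' hlt.le, mul_comm, heq, mul_comm]
  rcases hne.lt_or_gt with h | h
  · exact key _ hi' _ hi h heq.symm
  · exact key _ hi _ hi' h heq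

theorem eq_zero_of_val_le_pow [FiniteDimensional (LaurentSeries k) D] {x : D}
    (h : ∀ N : ℕ, w x ≤ w (uniformizer w k : D) ^ N) : x = 0 := by
  by_contra hx
  obtain ⟨e, he, -, j, hj⟩ := exists_val_pow_eq (k := k) w hx
  -- With `N = |j| + 1` the bound would force `e (|j| + 1) ≤ j`.
  have h1 := pow_le_pow_left₀ zero_le (h (j.natAbs + 1)) e
  rw [hj, ← pow_mul, ← zpow_natCast] at h1
  have h2 := (zpow_le_zpow_iff_right_of_lt_one₀
    (zero_lt_iff.2 (val_uniformizer_ne_zero (k := k) w)) (val_uniformizer_lt_one (k := k) w)).1 h1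
  push_cast at h2
  nlinarith [abs_nonneg j, le_abs_self j]

theorem exists_isParameter (k : Type*) [Field k] [Algebra (LaurentSeries k) D]
    [Valuation.HasExtension
      (Valued.v : Valuation (LaurentSeries k) (WithZero (Multiplicative ℤ))) w]
    [FiniteDimensional (LaurentSeries k) D] : ∃ z : D, IsParameter w z := by
  set T := w (uniformizer w k : D) with hT
  have hT0 : T ≠ 0 := val_uniformizer_ne_zero w
  have hT1 : T < 1 := val_uniformizer_lt_one w
  -- Every exponent `e` of `exists_val_pow_eq` divides this `N`, so `N`-th powers embed the value
  -- group in the powers of `T`, that is, in `ℤ`; a generator of the image gives the parameter.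
  set N := (Module.finrank (LaurentSeries k) D).factorial with hN
  have hN0 : N ≠ 0 := Nat.factorial_ne_zero _
  have hpow : ∀ x : D, x ≠ 0 → ∃ j : ℤ, w x ^ N = T ^ j := by
    intro x hx
    obtain ⟨e, he, hle, j, hj⟩ := exists_val_pow_eq (k := k) w hx
    obtain ⟨q, hq⟩ := Nat.dvd_factorial he hle
    exact ⟨j * q, by rw [hN, hq, pow_mul, hj, zpow_mul, zpow_natCast]⟩
  let S : AddSubgroup ℤ :=
    { carrier := {j | ∃ x : D, x ≠ 0 ∧ w x ^ N = T ^ j}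
      zero_mem' := ⟨1, one_ne_zero, by simp⟩
      add_mem' := by
        rintro a b ⟨x, hx, hxa⟩ ⟨y, hy, hyb⟩
        exact ⟨x * y, mul_ne_zero hx hy, by rw [map_mul, mul_pow, hxa, hyb, zpow_add₀ hT0]⟩
      neg_mem' := by
        rintro a ⟨x, hx, hxa⟩
        exact ⟨x⁻¹, inv_ne_zero hx, by rw [map_inv₀, inv_pow, hxa, zpow_neg]⟩ }
  obtain ⟨g, hg⟩ := Int.subgroup_cyclic S
  have hmem : (N : ℤ) ∈ S :=
    ⟨uniformizer w k, w.ne_zero_iff.1 hT0, by rw [zpow_natCast]⟩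
  have hg0 : g ≠ 0 := by
    rintro rfl
    rw [hg, AddSubgroup.mem_closure_singleton] at hmem
    obtain ⟨n, hn⟩ := hmem
    simp only [smul_zero] at hn
    omega
  -- The positive generator is the one that yields a value below 1.
  have hgS : |g| ∈ S := by
    have : g ∈ S := hg ▸ AddSubgroup.subset_closure rfl
    rcases abs_choice g with h | h <;> rw [h]
    exacts [this, neg_mem this]
  obtain ⟨z, hz, hzg⟩ := hgS
  have inj : ∀ {a b : Γ₀}, a ^ N = b ^ N → a = b := fun h => (pow_left_inj₀ zero_le zero_le hN0).1 h
  refine ⟨z, hz, ?_, fun x hx => ?_⟩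
  · rw [← pow_lt_one_iff_of_nonneg zero_le hN0, hzg]
    rw [← zpow_zero T, zpow_lt_zpow_iff_right_of_lt_one₀ (zero_lt_iff.2 hT0) hT1]
    exact abs_pos.2 hg0
  · obtain ⟨j, hj⟩ := hpow x hx
    have : j ∈ S := ⟨x, hx, hj⟩
    rw [hg, AddSubgroup.mem_closure_singleton] at this
    obtain ⟨i, hi⟩ := this
    obtain ⟨s, hs⟩ : ∃ s : ℤ, j = |g| * s := by
      obtain ⟨s, hs⟩ := (abs_dvd g j).2 ⟨i, by rw [← hi, smul_eq_mul, mul_comm]⟩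
      exact ⟨s, hs⟩
    refine ⟨s, inj ?_⟩
    rw [hj, hs, zpow_mul, ← hzg, ← zpow_natCast, ← zpow_natCast, ← zpow_mul, ← zpow_mul, mul_comm]

end

/-! ### Lifting linear independence from the quotient by the uniformizer. -/

section

variable {k : Type*} [Field k] {D : Type*} [Ring D] [Algebra (LaurentSeries k) D]
  {Γ₀ : Type*} [LinearOrderedCommGroupWithZero Γ₀] {w : Valuation D Γ₀}
  [Valuation.HasExtension (Valued.v : Valuation (LaurentSeries k) (WithZero (Multiplicative ℤ))) w]

theorem coefficient_smul_def (c : k) (x : w.integer) :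
    c • x = (PowerSeries.C c : k⟦X⟧) • x :=
  rfl

theorem X_smul_integer (x : w.integer) :
    (PowerSeries.X : k⟦X⟧) • x = uniformizer w k * x :=
  Algebra.smul_def _ _

/-- Elements of the valuation ring that are independent over the coefficient field modulo the
uniformizer are independent over the field of Laurent series. -/
theorem linearIndependent_of_mod_uniformizer [IsDomain D] {ι : Type*} [Fintype ι]
    (y : ι → w.integer)
    (h : ∀ c : ι → k, uniformizer w k ∣ ∑ i, c i • y i → c = 0) :
    LinearIndependent (LaurentSeries k) fun i => (y i : D) := by
  have ht : uniformizer w k ≠ 0 := fun h0 =>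
    val_uniformizer_ne_zero (k := k) w (by rw [h0]; simp)
  -- By `h` the constant terms of a relation over `k⟦X⟧` vanish; dividing by the uniformizer leaves
  -- another relation, so the argument repeats.
  have dvd : ∀ (N : ℕ) (a : ι → k⟦X⟧), ∑ i, a i • y i = 0 →
      ∀ i, (PowerSeries.X : k⟦X⟧) ^ N ∣ a i := by
    intro N
    induction N with
    | zero => simp
    | succ N ih =>
      intro a ha
      choose b hb using fun i =>
        (⟨_, sub_eq_iff_eq_add'.1 (PowerSeries.sub_const_eq_X_mul_shift (a i))⟩ :
        ∃ b : k⟦X⟧, a i = PowerSeries.C (PowerSeries.constantCoeff (a i)) + PowerSeries.X * b)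
      have hsum : ∑ i, PowerSeries.constantCoeff (a i) • y i
          + uniformizer w k * ∑ i, b i • y i = 0 := by
        rw [← ha, Finset.mul_sum, ← Finset.sum_add_distrib]
        refine Finset.sum_congr rfl fun i _ => ?_
        conv_rhs => rw [hb i, add_smul, mul_smul, X_smul_integer]
        rw [coefficient_smul_def]
      have hc := h (fun i => PowerSeries.constantCoeff (a i))
        ⟨-∑ i, b i • y i, by rw [mul_neg]; exact eq_neg_of_add_eq_zero_left hsum⟩
      have hb0 : ∑ i, b i • y i = 0 := by
        have h2 : ∑ i, PowerSeries.constantCoeff (a i) • y i = 0 :=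
          Finset.sum_eq_zero fun i _ => by rw [congrFun hc i]; simp
        rw [h2, zero_add] at hsum
        exact (mul_eq_zero.1 hsum).resolve_left ht
      intro i
      rw [hb i, congrFun hc i, Pi.zero_apply, map_zero, zero_add, pow_succ']
      exact mul_dvd_mul_left _ (ih b hb0 i)
  rw [Fintype.linearIndependent_iff]
  intro g hg
  obtain ⟨b, hb⟩ := IsLocalization.exist_integer_multiples_of_finite (nonZeroDivisors k⟦X⟧) g
  choose a ha using hb
  have hb0 : algebraMap k⟦X⟧ (LaurentSeries k) (b : k⟦X⟧) ≠ 0 :=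
    IsFractionRing.to_map_ne_zero_of_mem_nonZeroDivisors b.2
  have hsum : ∑ i, a i • y i = 0 := by
    apply Subtype.ext
    rw [AddSubmonoidClass.coe_finsetSum, ZeroMemClass.coe_zero, ← smul_zero
      (algebraMap k⟦X⟧ (LaurentSeries k) (b : k⟦X⟧)), ← hg, Finset.smul_sum]
    refine Finset.sum_congr rfl fun i _ => ?_
    rw [Algebra.smul_def, MulMemClass.coe_mul, coe_algebraMap_powerSeries, smul_smul,
      Algebra.smul_def (R := LaurentSeries k)]
    congr 2
    have := ha i
    rw [Algebra.smul_def] at this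
    exact this
  intro i
  have hai : a i = 0 := by
    ext n
    rw [map_zero]
    exact PowerSeries.X_pow_dvd_iff.1 (dvd (n + 1) a hsum i) n n.lt_succ_self
  have := ha i
  rw [hai, map_zero, Algebra.smul_def] at this
  exact (mul_eq_zero.1 this.symm).resolve_left hb0

end

/-! ### Completeness and Hensel's lemma in the commutative case. -/

section

variable {k : Type*} [Field k] {K : Type*} [Field K] [Algebra (LaurentSeries k) K]
  {Γ₀ : Type*} [LinearOrderedCommGroupWithZero Γ₀] {w : Valuation K Γ₀}
  [Valuation.HasExtension (Valued.v : Valuation (LaurentSeries k) (WithZero (Multiplicative ℤ))) w]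

theorem dvd_of_val_le {a b : w.integer} (hb : b ≠ 0) (h : w (a : K) ≤ w (b : K)) : b ∣ a := by
  have hb' : (b : K) ≠ 0 := fun h0 => hb (Subtype.ext h0)
  refine ⟨⟨(b : K)⁻¹ * a, ?_⟩, Subtype.ext ?_⟩
  · change w _ ≤ 1
    rw [map_mul, map_inv₀, mul_comm]
    exact mul_inv_le_one_of_le₀ h zero_le
  · simp [hb']

theorem uniformizer_ne_zero : uniformizer w k ≠ 0 := fun h0 =>
  val_uniformizer_ne_zero (k := k) w (by rw [h0]; simp)

variable [FiniteDimensional (LaurentSeries k) K]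

instance finite_quotient_uniformizer :
    Module.Finite k (w.integer ⧸ Ideal.span {uniformizer w k}) := by
  have hrank : Module.rank k (w.integer ⧸ Ideal.span {uniformizer w k})
      ≤ Module.finrank (LaurentSeries k) K := by
    refine rank_le fun s hs => ?_
    choose y hy using fun i : s => Ideal.Quotient.mk_surjective (I := Ideal.span {uniformizer w k})
      (i : w.integer ⧸ Ideal.span {uniformizer w k})
    have hli := linearIndependent_of_mod_uniformizer y fun c hc => by
      rw [← Ideal.mem_span_singleton, ← Ideal.Quotient.eq_zero_iff_mem] at hc
      have hc' : Ideal.Quotient.mkₐ k (Ideal.span {uniformizer w k}) (∑ i, c i • y i) = 0 := hc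
      rw [map_sum] at hc'
      simp only [map_smul, Ideal.Quotient.mkₐ_eq_mk, hy] at hc'
      exact funext (Fintype.linearIndependent_iff.1 hs c hc')
    simpa using hli.fintype_card_le_finrank
  exact Module.rank_lt_aleph0_iff.1 (hrank.trans_lt (Cardinal.natCast_lt_aleph0))

/-- The valuation ring of a finite extension of the field of Laurent series is complete. -/
instance isAdicComplete_integer :
    IsAdicComplete (Ideal.span {uniformizer w k}) w.integer where
  haus' x hx := by
    apply Subtype.ext
    refine eq_zero_of_val_le_pow (k := k) w fun N => ?_
    have := hx N
    rw [SModEq.zero, smul_eq_mul, Ideal.mul_top, Ideal.span_singleton_pow,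
      Ideal.mem_span_singleton] at this
    obtain ⟨r, rfl⟩ := this
    rw [MulMemClass.coe_mul, map_mul, SubmonoidClass.coe_pow, map_pow]
    exact mul_le_of_le_one_right' r.2
  prec' f hf := by
    set t := uniformizer w k with ht
    have mem : ∀ {x y : w.integer} {n : ℕ},
        x ≡ y [SMOD (Ideal.span {t} ^ n • ⊤ : Submodule w.integer w.integer)]
          ↔ t ^ n ∣ y - x := by
      intro x y n
      rw [SModEq.comm, SModEq.sub_mem, smul_eq_mul, Ideal.mul_top, Ideal.span_singleton_pow,
        Ideal.mem_span_singleton]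
    choose g hg using fun n => mem.1 (hf (Nat.le_succ n))
    let b := Module.finBasis k (w.integer ⧸ Ideal.span {t})
    choose y hy using fun i => Ideal.Quotient.mk_surjective (b i)
    have hexp : ∀ x : w.integer, ∃ (c : Fin _ → k) (r : w.integer),
        x = ∑ i, c i • y i + t * r := by
      intro x
      have hx : x - ∑ i, b.repr (Ideal.Quotient.mk _ x) i • y i ∈ Ideal.span {t} := by
        rw [← Ideal.Quotient.eq_zero_iff_mem]
        change Ideal.Quotient.mkₐ k (Ideal.span {t}) _ = 0
        rw [map_sub, map_sum]
        simp only [map_smul, Ideal.Quotient.mkₐ_eq_mk, hy, b.sum_repr, sub_self]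
      obtain ⟨r, hr⟩ := Ideal.mem_span_singleton.1 hx
      exact ⟨_, r, sub_eq_iff_eq_add'.1 hr⟩
    choose c ρ hρ using hexp
    -- Addition with carries: `f (n + 1) - f n = t ^ n * g n`, position `n` receives the carry `ρ'
    -- n`, keeps the digit `∑ j, c (h n) j • y j`, and passes `ρ (h n)` on.
    let h : ℕ → w.integer := fun n => Nat.rec (g 0) (fun n x => g (n + 1) + ρ x) n
    let ρ' : ℕ → w.integer := fun n => Nat.rec 0 (fun n _ => ρ (h n)) n
    have hh : ∀ n, h n = g n + ρ' n := by
      intro n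
      cases n with
      | zero => exact (add_zero _).symm
      | succ n => rfl
    have hfN : ∀ N, f N = f 0 + ∑ i ∈ Finset.range N, t ^ i * ∑ j, c (h i) j • y j
        + t ^ N * ρ' N := by
      intro N
      induction N with
      | zero => simp [ρ']
      | succ N ih =>
        rw [Finset.sum_range_succ, ← sub_add_cancel (f (N + 1)) (f N), hg, ih]
        have h1 : ρ' (N + 1) = ρ (h N) := rfl
        have h2 := hρ (h N)
        rw [h1]
        have h3 : g N = ∑ j, c (h N) j • y j + t * ρ (h N) - ρ' N := by
          rw [← h2, hh]; ring
        rw [h3]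
        ring
    -- The infinite sum of the digits from position `N` on exists because the digits have finitely
    -- many coordinates, each giving a power series over `k`.
    let A : ℕ → w.integer := fun N =>
      ∑ j, (PowerSeries.mk fun i => c (h (i + N)) j : k⟦X⟧) • y j
    have hA : ∀ N, A N = ∑ j, c (h N) j • y j + t * A (N + 1) := by
      intro N
      simp only [A]
      rw [Finset.mul_sum, ← Finset.sum_add_distrib]
      refine Finset.sum_congr rfl fun j _ => ?_
      rw [← X_smul_integer, ← mul_smul, coefficient_smul_def, ← add_smul]
      congr 1
      ext n
      cases n with
      | zero => simp
      | succ n => simp [PowerSeries.coeff_succ_X_mul, add_assoc, add_comm 1 N]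
    have hA0 : ∀ N, A 0 = ∑ i ∈ Finset.range N, t ^ i * ∑ j, c (h i) j • y j + t ^ N * A N := by
      intro N
      induction N with
      | zero => simp
      | succ N ih =>
        rw [Finset.sum_range_succ, ih, hA N]
        ring
    refine ⟨f 0 + A 0, fun n => mem.2 ⟨A n - ρ' n, ?_⟩⟩
    rw [hfN n, hA0 n]
    ring

/-- Hensel's lemma for the valuation ring of a finite extension of the field of Laurent series. -/
theorem exists_root_of_val_aeval_lt_one {f : k[X]} (hf : f.Monic) (a : w.integer)
    (h : w (aeval a f : w.integer) < 1) (h' : IsUnit (aeval a (derivative f))) :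
    ∃ c : w.integer, aeval c f = 0 ∧ w ((c - a : w.integer) : K) < 1 := by
  set t := uniformizer w k with ht
  -- Ramification may make the ideal of `t` smaller than the maximal ideal, so `f(a)` is only
  -- nilpotent modulo `t`. A root modulo `t` is found first by the nilpotent Newton method, then
  -- lifted by completeness.
  have hnil : ∃ e : ℕ, t ∣ aeval a f ^ e := by
    by_cases h0 : ((aeval a f : w.integer) : K) = 0
    · exact ⟨1, by rw [pow_one, show (aeval a f : w.integer) = 0 from Subtype.ext h0]; simp⟩
    · obtain ⟨e, he, -, j, hj⟩ := exists_val_pow_eq (k := k) w h0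
      refine ⟨e, dvd_of_val_le uniformizer_ne_zero ?_⟩
      have hT := zero_lt_iff.2 (val_uniformizer_ne_zero (k := k) w)
      have hT1 := val_uniformizer_lt_one (k := k) w
      have hlt : w (aeval a f : w.integer) ^ e < 1 := pow_lt_one' h he.ne'
      rw [SubmonoidClass.coe_pow, map_pow, hj]
      rw [hj, ← zpow_zero (w (uniformizer w k : K)),
        zpow_lt_zpow_iff_right_of_lt_one₀ hT hT1] at hlt
      conv_rhs => rw [← zpow_one (w (t : K))]
      exact (zpow_le_zpow_iff_right_of_lt_one₀ hT hT1).2 hlt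
  obtain ⟨e, he⟩ := hnil
  let φ := Ideal.Quotient.mkₐ k (Ideal.span {t})
  have hφ : ∀ x, φ x = 0 ↔ t ∣ x := fun x => by
    rw [← Ideal.mem_span_singleton, ← Ideal.Quotient.eq_zero_iff_mem]; rfl
  have h1 : IsNilpotent (aeval (φ a) f) :=
    ⟨e, by rw [aeval_algHom_apply, ← map_pow, hφ]; exact he⟩
  have h2 : IsUnit (aeval (φ a) (derivative f)) := by
    rw [aeval_algHom_apply]; exact h'.map φ
  obtain ⟨r', ⟨hr1, hr2⟩, -⟩ := existsUnique_nilpotent_sub_and_aeval_eq_zero h1 h2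
  obtain ⟨r, rfl⟩ := Ideal.Quotient.mk_surjective r'
  change IsNilpotent (φ a - φ r) at hr1
  change aeval (φ r) f = 0 at hr2
  have h3 : IsUnit (aeval (φ r) (derivative f)) :=
    isUnit_aeval_of_isUnit_aeval_of_isNilpotent_sub h2 (by
      rw [← neg_sub, isNilpotent_neg_iff]; exact hr1)
  rw [aeval_algHom_apply] at hr2 h3
  obtain ⟨c, hc, hcr⟩ := HenselianRing.is_henselian (I := Ideal.span {t})
    (f.map (algebraMap k w.integer)) (hf.map _) r
    (by rw [eval_map_algebraMap, Ideal.mem_span_singleton]; exact (hφ _).1 hr2)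
    (by rw [derivative_map, eval_map_algebraMap]; exact h3)
  refine ⟨c, by rwa [IsRoot, eval_map_algebraMap] at hc, ?_⟩
  have ht1 : w (t : K) < 1 := val_uniformizer_lt_one w
  have hlt : ∀ x : w.integer, t ∣ x → w (x : K) < 1 := by
    rintro _ ⟨s, rfl⟩
    rw [MulMemClass.coe_mul, map_mul]
    exact (mul_le_of_le_one_right' s.2).trans_lt ht1
  obtain ⟨m, hm⟩ := hr1
  rw [← map_sub, ← map_pow, hφ] at hm
  have har : w ((a - r : w.integer) : K) < 1 := by
    have := hlt _ hm
    rw [SubmonoidClass.coe_pow, map_pow] at this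
    by_contra hcon
    exact absurd this (not_lt.2 (one_le_pow_of_one_le' (not_lt.1 hcon) m))
  have := w.map_sub_lt (hlt _ (Ideal.mem_span_singleton.1 hcr)) har
  simpa using this

end

/-! ### The residue division ring, and Hensel's lemma in `D`. -/

section

variable {D : Type*} [DivisionRing D] {Γ₀ : Type*} [LinearOrderedCommGroupWithZero Γ₀]
  {w : Valuation D Γ₀}

theorem residue_surjective : Function.Surjective (residue w) :=
  Ideal.Quotient.mk_surjective

theorem residue_ne_zero_iff (x : w.integer) : residue w x ≠ 0 ↔ w (x : D) = 1 := by
  rw [Ne, residue_eq_zero_iff, not_lt]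
  exact ⟨fun h => le_antisymm x.2 h, fun h => h.ge⟩

theorem isUnit_of_residue_ne_zero {x : w.integer} (hx : residue w x ≠ 0) : IsUnit x := by
  have h1 := (residue_ne_zero_iff x).1 hx
  have hx0 : (x : D) ≠ 0 := w.ne_zero_iff.1 (by rw [h1]; exact one_ne_zero)
  have hinv : w (x : D)⁻¹ ≤ 1 := by rw [map_inv₀, h1, inv_one]
  exact ⟨⟨x, ⟨(x : D)⁻¹, hinv⟩, Subtype.ext (mul_inv_cancel₀ hx0),
    Subtype.ext (inv_mul_cancel₀ hx0)⟩, rfl⟩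

instance : Nontrivial (Residue w) :=
  ⟨⟨1, 0, by rw [← map_one (residue w), residue_ne_zero_iff, OneMemClass.coe_one, map_one]⟩⟩

noncomputable instance residueDivisionRing : DivisionRing (Residue w) :=
  DivisionRing.ofIsUnitOrEqZero fun a => by
    obtain ⟨x, rfl⟩ := residue_surjective a
    exact or_iff_not_imp_right.2 fun hx => (isUnit_of_residue_ne_zero hx).map (residue w)

end

section

variable {k : Type*} [Field k] {D : Type*} [DivisionRing D] [Algebra (LaurentSeries k) D]
  {Γ₀ : Type*} [LinearOrderedCommGroupWithZero Γ₀] {w : Valuation D Γ₀}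
  [Valuation.HasExtension (Valued.v : Valuation (LaurentSeries k) (WithZero (Multiplicative ℤ))) w]

variable (w) in
/-- The residue homomorphism as a homomorphism of algebras over the coefficient field. -/
noncomputable def residueAlgHom (k : Type*) [Field k] [Algebra (LaurentSeries k) D]
    [Valuation.HasExtension
      (Valued.v : Valuation (LaurentSeries k) (WithZero (Multiplicative ℤ))) w] :
    w.integer →ₐ[k] Residue w :=
  Ideal.Quotient.mkₐ k (maxIdeal w)

@[simp]
theorem residueAlgHom_apply (x : w.integer) : residueAlgHom w k x = residue w x :=
  rfl

noncomputable instance centerAlgebra : Algebra k (Subring.center (Residue w)) :=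
  RingHom.toAlgebra ((algebraMap k (Residue w)).codRestrict (Subring.center (Residue w))
    fun c => Subring.mem_center_iff.2 fun x => (Algebra.commutes c x).symm)

theorem coe_algebraMap_center (c : k) :
    (algebraMap k (Subring.center (Residue w)) c : Residue w) = algebraMap k (Residue w) c :=
  rfl

variable (w) in
/-- The inclusion of the center of the residue division ring. -/
noncomputable def centerVal (k : Type*) [Field k] [Algebra (LaurentSeries k) D]
    [Valuation.HasExtension
      (Valued.v : Valuation (LaurentSeries k) (WithZero (Multiplicative ℤ))) w] :
    Subring.center (Residue w) →ₐ[k] Residue w :=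
  { (Subring.center (Residue w)).subtype with commutes' := fun _ => rfl }

@[simp]
theorem centerVal_apply (x : Subring.center (Residue w)) : centerVal w k x = x :=
  rfl

theorem residue_uniformizer : residue w (uniformizer w k) = 0 :=
  (residue_eq_zero_iff _).2 (val_uniformizer_lt_one w)

/-- Lifts of elements of the residue division ring that are independent over the coefficient field
are independent over the field of Laurent series. -/
theorem linearIndependent_of_residue {ι : Type*} [Fintype ι] {y : ι → w.integer}
    (h : LinearIndependent k fun i => residue w (y i)) :
    LinearIndependent (LaurentSeries k) fun i => (y i : D) := by
  refine linearIndependent_of_mod_uniformizer y fun c hc => ?_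
  obtain ⟨r, hr⟩ := hc
  have := congrArg (residueAlgHom w k) hr
  rw [map_sum, map_mul, residueAlgHom_apply (uniformizer w k), residue_uniformizer,
    zero_mul] at this
  simp only [map_smul, residueAlgHom_apply] at this
  exact funext (Fintype.linearIndependent_iff.1 h c this)

theorem finite_residue [FiniteDimensional (LaurentSeries k) D] : Module.Finite k (Residue w) := by
  have hrank : Module.rank k (Residue w) ≤ Module.finrank (LaurentSeries k) D := by
    refine rank_le fun s hs => ?_
    choose y hy using fun i : s => residue_surjective (i : Residue w)
    have hli := linearIndependent_of_residue (k := k) (y := y) (by simpa only [hy] using hs)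
    simpa using hli.fintype_card_le_finrank
  exact Module.rank_lt_aleph0_iff.1 (hrank.trans_lt (Cardinal.natCast_lt_aleph0))

theorem finite_center [FiniteDimensional (LaurentSeries k) D] :
    Module.Finite k (Subring.center (Residue w)) :=
  have := finite_residue (k := k) (w := w)
  Module.Finite.of_injective (centerVal w k).toLinearMap Subtype.val_injective

/-- Hensel's lemma: the root lies in the closure of the commutative algebra generated by the
approximate root, and therefore commutes with everything that commutes with the latter. -/
theorem exists_root_of_residue [FiniteDimensional (LaurentSeries k) D] {f : k[X]} (hf : f.Monic)
    (a : w.integer) (h : residue w (aeval a f) = 0)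
    (h' : residue w (aeval a (derivative f)) ≠ 0) :
    ∃ c : w.integer, aeval c f = 0 ∧ residue w c = residue w a ∧
      ∀ d : D, Commute d a → Commute d c := by
  let A := Algebra.adjoin (LaurentSeries k) {(a : D)}
  have : IsMulCommutative A := Algebra.isMulCommutative_adjoin (LaurentSeries k) (by
    rintro x rfl y rfl; rfl)
  let _ : Field A := fieldOfFiniteDimensional (LaurentSeries k) A
  let v : Valuation A Γ₀ := w.comap A.val.toRingHom
  have : Valuation.HasExtension
      (Valued.v : Valuation (LaurentSeries k) (WithZero (Multiplicative ℤ))) v :=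
    ⟨fun x y => Valuation.HasExtension.val_isEquiv_comap
      (vR := (Valued.v : Valuation (LaurentSeries k) (WithZero (Multiplicative ℤ)))) (vA := w) x y⟩
  let ψ : v.integer →ₐ[k] w.integer :=
    { toFun := fun x => ⟨((x : A) : D), x.2⟩
      map_one' := rfl
      map_mul' := fun _ _ => rfl
      map_zero' := rfl
      map_add' := fun _ _ => rfl
      commutes' := fun _ => rfl }
  let a' : v.integer := ⟨⟨a, Algebra.self_mem_adjoin_singleton _ _⟩, a.2⟩
  have ha' : ψ a' = a := rfl
  have hval : ∀ x : v.integer, v (x : A) = w (ψ x : D) := fun _ => rfl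
  rw [← ha', aeval_algHom_apply] at h h'
  have hu : IsUnit (aeval a' (derivative f)) := by
    rw [residue_ne_zero_iff, ← hval] at h'
    exact isUnit_of_residue_ne_zero ((residue_ne_zero_iff _).2 h')
  obtain ⟨c, hc, hca⟩ := exists_root_of_val_aeval_lt_one hf a'
    (by rw [hval]; exact (residue_eq_zero_iff _).1 h) hu
  refine ⟨ψ c, by rw [aeval_algHom_apply, hc, map_zero], ?_, fun d hd => ?_⟩
  · rw [hval, ← residue_eq_zero_iff, map_sub, map_sub, sub_eq_zero] at hca
    exact hca
  · have hcent : A ≤ Subalgebra.centralizer (LaurentSeries k) {d} := by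
      refine Algebra.adjoin_le ?_
      rintro _ rfl
      rw [SetLike.mem_coe, Subalgebra.mem_centralizer_iff]
      rintro _ rfl
      exact hd
    exact Subalgebra.mem_centralizer_iff (LaurentSeries k) |>.1 (hcent (c : A).2) d rfl

end

end DeltaMaps

namespace DeltaMaps

open Polynomial

/-! ### Intertwining two roots of a polynomial in a noncommutative ring. -/

section

/-- A vanishing sum of two-sided multiplications, with independent right factors over the center,
has vanishing left factors. -/
theorem eq_zero_of_forall_sum_mul_mul_eq_zero {F D ι : Type*} [Field F] [DivisionRing D]
    [Algebra F D] [Algebra.IsCentral F D] {c : ι → D} (hc : LinearIndependent F c) (s : Finset ι)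
    (q : ι → D) (h : ∀ d : D, ∑ i ∈ s, q i * d * c i = 0) : ∀ i ∈ s, q i = 0 := by
  classical
  induction s using Finset.induction_on generalizing q with
  | empty => simp
  | insert i₀ s hi₀ ih =>
    by_cases h0 : q i₀ = 0
    · intro i hi
      rcases Finset.mem_insert.1 hi with rfl | hi
      · exact h0
      · exact ih q (fun d => by simpa [Finset.sum_insert hi₀, h0] using h d) i hi
    · exfalso
      have h1 : ∀ d : D, ∑ i ∈ insert i₀ s, (q i₀)⁻¹ * q i * d * c i = 0 := fun d => by
        simpa only [Finset.mul_sum, mul_assoc, mul_zero] using congrArg ((q i₀)⁻¹ * ·) (h d)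
      -- Subtracting `e` times the relation at `d` from the relation at `e * d` cancels the
      -- normalized term `i₀`. The shorter relation makes the ratios commute with `e`, hence lie in
      -- `F`; at `d = 1` this contradicts the independence of `c`.
      have hcomm : ∀ e : D, ∀ i ∈ s, (q i₀)⁻¹ * q i * e - e * ((q i₀)⁻¹ * q i) = 0 := by
        intro e
        refine ih _ fun d => ?_
        have h2 := congrArg (e * ·) (h1 d)
        have h3 := h1 (e * d)
        simp only [mul_zero, Finset.sum_insert hi₀, inv_mul_cancel₀ h0, one_mul, mul_add,
          Finset.mul_sum] at h2 h3
        rw [← sub_eq_zero_of_eq (h3.trans h2.symm), mul_assoc e d, add_sub_add_left_eq_sub,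
          ← Finset.sum_sub_distrib]
        refine Finset.sum_congr rfl fun i _ => ?_
        simp only [sub_mul, mul_assoc]
      have hcent : ∀ i ∈ insert i₀ s, ∃ r : F, algebraMap F D r = (q i₀)⁻¹ * q i := by
        intro i hi
        rcases Finset.mem_insert.1 hi with rfl | hi
        · exact ⟨1, by rw [map_one, inv_mul_cancel₀ h0]⟩
        · refine Algebra.mem_bot.1 (Algebra.IsCentral.out ?_)
          rw [Subalgebra.mem_center_iff]
          intro e
          exact (sub_eq_zero.1 (hcomm e i hi)).symm
      choose! r hr using hcent
      have h2 : ∑ i ∈ insert i₀ s, r i • c i = 0 := by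
        rw [← h1 1]
        refine Finset.sum_congr rfl fun i hi => ?_
        rw [Algebra.smul_def, hr i hi, mul_one]
      have h3 := linearIndependent_iff'.1 hc _ _ h2 i₀ (Finset.mem_insert_self _ _)
      have h4 := hr i₀ (Finset.mem_insert_self _ _)
      rw [h3, map_zero, inv_mul_cancel₀ h0] at h4
      exact zero_ne_one h4

/-- Two roots of a monic polynomial over the center are conjugate, if the powers of one of them
are independent up to the degree of the polynomial. -/
theorem exists_mul_eq_mul_of_aeval_eq_zero {F D : Type*} [Field F] [DivisionRing D] [Algebra F D]
    [Algebra.IsCentral F D] {f : F[X]} (hf : f.Monic) (hf0 : 0 < f.natDegree) {b c : D}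
    (hb : aeval b f = 0) (hc : aeval c f = 0)
    (hli : LinearIndependent F fun i : Fin f.natDegree => c ^ (i : ℕ)) :
    ∃ x : D, x ≠ 0 ∧ b * x = x * c := by
  set n := f.natDegree with hn
  let p : ℕ → F[X] := fun j => divX^[j] f
  have h1 : ∀ (j i : ℕ) (g : F[X]), (divX^[j] g).coeff i = g.coeff (i + j) := by
    intro j
    induction j with
    | zero => simp
    | succ j ih => intro i g; rw [Function.iterate_succ_apply, ih, coeff_divX]; rfl
  have hp : ∀ j, p j = X * p (j + 1) + C (f.coeff j) := by
    intro j
    have h2 : p (j + 1) = divX (p j) := Function.iterate_succ_apply' _ _ _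
    rw [h2, ← zero_add j, ← h1, zero_add, X_mul_divX_add]
  have hpn : p n = 1 := by
    ext i
    rw [h1, coeff_one]
    rcases i with - | i
    · rw [zero_add, hn, hf.coeff_natDegree, if_pos rfl]
    · simpa using coeff_eq_zero_of_natDegree_lt (by omega)
  let q : ℕ → D := fun j => aeval b (p (j + 1))
  by_contra! hcon
  -- The sum `S` intertwines `b` and `c` for every `d`: by Horner's recursion `b S - S c` telescopes
  -- to `f(b) d - d f(c) = 0`. If all these sums vanished, so would every `q i`, but `q (n - 1) =
  -- 1`.
  have hzero : ∀ d : D, ∑ i : Fin n, q i * d * c ^ (i : ℕ) = 0 := by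
    intro d
    by_contra hd
    refine hcon _ hd ?_
    have tele : ∀ j, b * (q j * d * c ^ j) - q j * d * c ^ j * c
        = aeval b (p j) * d * c ^ j - aeval b (p (j + 1)) * d * c ^ (j + 1)
          - d * (f.coeff j • c ^ j) := by
      intro j
      rw [hp j]
      simp only [q, map_add, map_mul, aeval_X, aeval_C, add_mul, pow_succ, Algebra.smul_def,
        mul_assoc]
      rw [Algebra.left_comm]
      abel
    rw [← sub_eq_zero, Finset.mul_sum, Finset.sum_mul, ← Finset.sum_sub_distrib,
      Finset.sum_congr rfl fun (i : Fin n) _ => tele i, Fin.sum_univ_eq_sum_range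
      (fun j => aeval b (p j) * d * c ^ j - aeval b (p (j + 1)) * d * c ^ (j + 1)
          - d * (f.coeff j • c ^ j)) n, Finset.sum_sub_distrib, Finset.sum_range_sub', hpn,
      ← Finset.mul_sum]
    have h0 : p 0 = f := rfl
    rw [h0, hb, map_one, one_mul, zero_mul, zero_mul]
    have h1 : aeval c f = ∑ i ∈ Finset.range n, f.coeff i • c ^ i + c ^ n := by
      rw [aeval_eq_sum_range, Finset.sum_range_succ, ← hn, hn, hf.coeff_natDegree, one_smul]
    rw [hc] at h1
    rw [zero_sub, ← neg_add', ← mul_add, add_comm, ← h1, mul_zero, neg_zero]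
  have := eq_zero_of_forall_sum_mul_mul_eq_zero hli Finset.univ (fun i => q i) hzero
    ⟨n - 1, by omega⟩ (Finset.mem_univ _)
  simp only [q] at this
  rw [Nat.sub_add_cancel hf0, hpn, map_one] at this
  exact one_ne_zero this

/-- The difference of the values of a polynomial at two elements, as a twisted multiple. -/
theorem exists_mul_sub_mul_eq_aeval_sub {k V R : Type*} [CommRing k] [Ring V] [Ring R]
    [Algebra k V] [Algebra k R] (ρ : V →ₐ[k] R) {b c : V} (h : ρ b = ρ c) (f : k[X]) :
    ∃ x : V, b * x - x * c = aeval b f - aeval c f ∧ ρ x = aeval (ρ c) (derivative f) := by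
  induction f using Polynomial.induction_on with
  | C a => exact ⟨0, by simp, by simp⟩
  | add f g hf hg =>
    obtain ⟨x, hx, hx'⟩ := hf
    obtain ⟨y, hy, hy'⟩ := hg
    refine ⟨x + y, ?_, by simp [hx', hy']⟩
    rw [map_add, map_add, add_sub_add_comm, ← hx, ← hy, mul_add, add_mul, add_sub_add_comm]
  | monomial n a ih =>
    obtain ⟨x, hx, hx'⟩ := ih
    rw [pow_succ', ← mul_assoc, ← X_mul_C a, mul_assoc]
    generalize C a * X ^ n = g at hx hx'
    -- The noncommutative difference quotient, with `b` kept to the left of `c`; it becomes the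
    -- derivative once `b` and `c` have the same image.
    refine ⟨b * x + aeval c g, ?_, ?_⟩
    · have hcomm : aeval c g * c = c * aeval c g := by
        simpa using congrArg (aeval c) (mul_comm g X)
      simp only [map_mul, aeval_X]
      rw [← sub_eq_zero] at hx ⊢
      calc _ = b * (b * x - x * c - (aeval b g - aeval c g)) + (c * aeval c g - aeval c g * c) := by
            noncomm_ring
        _ = 0 := by rw [hx, hcomm]; simp
    · simp only [map_add, map_mul, hx', h, derivative_mul, derivative_X, one_mul, aeval_X,
        aeval_algHom_apply]
      abel

end

/-! ### The action of conjugation on the center of the residue division ring. -/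

section

variable {k : Type*} [Field k] {D : Type*} [DivisionRing D] [Algebra (LaurentSeries k) D]
  {Γ₀ : Type*} [LinearOrderedCommGroupWithZero Γ₀] (w : Valuation D Γ₀)
  [Valuation.HasExtension (Valued.v : Valuation (LaurentSeries k) (WithZero (Multiplicative ℤ))) w]

/-- Conjugation by a nonzero element, on the valuation ring. -/
def unitConj (z : Dˣ) : w.integer →+* w.integer where
  toFun x := ⟨z * x * (z⁻¹ : Dˣ), by
    have hx : w (x : D) ≤ 1 := x.2
    have hz : w (z : D) ≠ 0 := w.ne_zero_iff.2 z.ne_zero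
    change w _ ≤ 1
    rwa [map_mul, map_mul, Units.val_inv_eq_inv_val, map_inv₀, mul_comm (w (z : D)),
      mul_inv_cancel_right₀ hz]⟩
  map_one' := by ext; simp
  map_zero' := by ext; simp
  map_mul' x y := by ext; simp [mul_assoc]
  map_add' x y := by ext; simp [mul_add, add_mul]

theorem coe_unitConj (z : Dˣ) (x : w.integer) :
    (unitConj w z x : D) = z * x * (z⁻¹ : Dˣ) :=
  rfl

theorem unitConj_mul (z z' : Dˣ) (x : w.integer) :
    unitConj w (z * z') x = unitConj w z (unitConj w z' x) := by
  ext; simp [coe_unitConj, mul_assoc]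

theorem unitConj_one (x : w.integer) : unitConj w 1 x = x := by
  ext; simp [coe_unitConj]

theorem unitConj_algebraMap (z : Dˣ) (a : k) :
    unitConj w z (algebraMap k w.integer a) = algebraMap k w.integer a := by
  ext
  rw [coe_unitConj, algebraMap_coefficient, coe_algebraMap_powerSeries, ← Algebra.commutes,
    Units.mul_inv_cancel_right]

/-- The automorphism induced by conjugation on the residue division ring. -/
noncomputable def residueConj (z : Dˣ) : Residue w →+* Residue w :=
  Ideal.Quotient.lift (maxIdeal w) ((residue w).comp (unitConj w z)) fun x hx => by
    have hx' : w (x : D) < 1 := hx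
    have hz : w (z : D) ≠ 0 := w.ne_zero_iff.2 z.ne_zero
    rw [RingHom.comp_apply, residue_eq_zero_iff, coe_unitConj]
    rwa [map_mul, map_mul, Units.val_inv_eq_inv_val, map_inv₀, mul_comm (w (z : D)),
      mul_inv_cancel_right₀ hz]

@[simp]
theorem residueConj_residue (z : Dˣ) (x : w.integer) :
    residueConj w z (residue w x) = residue w (unitConj w z x) :=
  rfl

theorem residueConj_mul (z z' : Dˣ) (a : Residue w) :
    residueConj w (z * z') a = residueConj w z (residueConj w z' a) := by
  obtain ⟨x, rfl⟩ := residue_surjective a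
  simp [unitConj_mul]

theorem residueConj_one (a : Residue w) : residueConj w 1 a = a := by
  obtain ⟨x, rfl⟩ := residue_surjective a
  simp [unitConj_one]

theorem residueConj_mem_center (z : Dˣ) {a : Residue w} (ha : a ∈ Subring.center (Residue w)) :
    residueConj w z a ∈ Subring.center (Residue w) := by
  rw [Subring.mem_center_iff] at ha ⊢
  intro b
  rw [← residueConj_one w b, ← mul_inv_cancel z, residueConj_mul, ← map_mul, ha, map_mul]

variable (k) in
/-- The endomorphism induced by conjugation on the center of the residue division ring. -/
noncomputable def centerConj (z : Dˣ) :
    Subring.center (Residue w) →ₐ[k] Subring.center (Residue w) :=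
  { (((residueConj w z).comp (Subring.center (Residue w)).subtype).codRestrict
      (Subring.center (Residue w)) fun a => residueConj_mem_center w z a.2) with
    commutes' := fun a => Subtype.ext
      (congrArg (residue w) (unitConj_algebraMap w z a)) }

theorem coe_centerConj (z : Dˣ) (a : Subring.center (Residue w)) :
    (centerConj k w z a : Residue w) = residueConj w z a :=
  rfl

variable (k) in
/-- The action of the multiplicative group by conjugation on the center of the residue division
ring. -/
noncomputable def centerAut :
    Dˣ →* (Subring.center (Residue w) ≃ₐ[k] Subring.center (Residue w)) where
  toFun z := AlgEquiv.ofAlgHom (centerConj k w z) (centerConj k w z⁻¹)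
    (by ext a; simp [coe_centerConj, ← residueConj_mul, residueConj_one])
    (by ext a; simp [coe_centerConj, ← residueConj_mul, residueConj_one])
  map_one' := by ext a; simp [coe_centerConj, residueConj_one]
  map_mul' z z' := by ext a; simp [coe_centerConj, residueConj_mul]

theorem coe_centerAut (z : Dˣ) (a : Subring.center (Residue w)) :
    (centerAut k w z a : Residue w) = residueConj w z a :=
  rfl

/-- Such a `v` is a unit of the valuation ring, so it acts on the residue division ring by an inner
automorphism. Hence the action on the center depends only on the value. -/
theorem centerAut_eq_one {v : Dˣ} (hv : w (v : D) = 1) : centerAut k w v = 1 := by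
  ext a
  have hvinv : w ((v⁻¹ : Dˣ) : D) = 1 := by rw [Units.val_inv_eq_inv_val, map_inv₀, hv, inv_one]
  let x : w.integer := ⟨v, hv.le⟩
  let y : w.integer := ⟨(v⁻¹ : Dˣ), hvinv.le⟩
  have hxy : x * y = 1 := Subtype.ext v.mul_inv
  obtain ⟨b, hb⟩ := residue_surjective (a : Residue w)
  have : unitConj w v b = x * b * y := rfl
  rw [coe_centerAut, ← hb, residueConj_residue, this, map_mul, map_mul, hb,
    Subring.mem_center_iff.1 a.2, mul_assoc, ← map_mul, hxy, map_one, mul_one]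
  rfl

end

end DeltaMaps

namespace DeltaMaps

open Polynomial

/-! ### The lifted separable closure, the adapted parameter and the expansion. -/

section

variable {k : Type*} [Field k] {D : Type*} [DivisionRing D] [Algebra (LaurentSeries k) D]
  {Γ₀ : Type*} [LinearOrderedCommGroupWithZero Γ₀] {w : Valuation D Γ₀}
  [Valuation.HasExtension (Valued.v : Valuation (LaurentSeries k) (WithZero (Multiplicative ℤ))) w]

theorem residue_algebraMap_powerSeries (g : PowerSeries k) :
    residue w (algebraMap (PowerSeries k) w.integer g)
      = algebraMap k (Residue w) (PowerSeries.constantCoeff g) := by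
  rw [← sub_add_cancel g (PowerSeries.C (PowerSeries.constantCoeff g)),
    PowerSeries.sub_const_eq_X_mul_shift, map_add, map_add, map_mul, map_mul]
  change residue w (uniformizer w k) * _ + algebraMap k (Residue w) _ = _
  rw [residue_uniformizer]
  simp

/-- The integral central elements are the power series, and the residue of a power series is its
constant term. -/
theorem mem_residueOfCenter_iff [Algebra.IsCentral (LaurentSeries k) D]
    {b : Subring.center (Residue w)} :
    b ∈ residueOfCenter w ↔ ∃ c : k, algebraMap k (Subring.center (Residue w)) c = b := by
  constructor
  · rintro ⟨x, hx, hxb⟩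
    obtain ⟨y, hy⟩ := Algebra.mem_bot.1 (Algebra.IsCentral.out (K := LaurentSeries k)
      (show (x : D) ∈ Subalgebra.center (LaurentSeries k) D from hx))
    obtain ⟨g, rfl⟩ := (algebraMap_mem_integer_iff w y).1 (hy ▸ x.2)
    refine ⟨PowerSeries.constantCoeff g, Subtype.ext ?_⟩
    rw [coe_algebraMap_center, ← residue_algebraMap_powerSeries]
    have : algebraMap (PowerSeries k) w.integer g = x := Subtype.ext hy
    rw [this]
    exact hxb
  · rintro ⟨c, rfl⟩
    refine ⟨algebraMap k w.integer c, ?_, rfl⟩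
    exact Subring.mem_center_iff.2 fun d => (Algebra.commutes _ d).symm

theorem galOrder_eq_card [Algebra.IsCentral (LaurentSeries k) D] :
    galOrder w = Nat.card (Subring.center (Residue w) ≃ₐ[k] Subring.center (Residue w)) := by
  refine Nat.card_congr ⟨fun σ => AlgEquiv.ofRingEquiv (f := σ.toRingEquiv) fun c =>
      σ.commutes ⟨_, (mem_residueOfCenter_iff (k := k)).2 ⟨c, rfl⟩⟩,
    fun σ => AlgEquiv.ofRingEquiv (f := σ.toRingEquiv) fun b => ?_, fun _ => rfl, fun _ => rfl⟩
  obtain ⟨c, hc⟩ := (mem_residueOfCenter_iff (k := k)).1 b.2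
  change σ (b : Subring.center (Residue w)) = b
  rw [← hc]
  exact σ.commutes c

variable (k w) in
/-- The separable closure of the coefficient field in the center of the residue division ring. -/
abbrev SeparableCenter : Type _ :=
  separableClosure k (Subring.center (Residue w))

/-- The restriction of an automorphism of the center to the separable closure. -/
noncomputable def sepAut (τ : Subring.center (Residue w) ≃ₐ[k] Subring.center (Residue w)) :
    SeparableCenter k w ≃ₐ[k] SeparableCenter k w :=
  AlgEquiv.separableClosure τ

theorem sepAut_mul (τ σ : Subring.center (Residue w) ≃ₐ[k] Subring.center (Residue w))
    (l : SeparableCenter k w) : sepAut (τ * σ) l = sepAut τ (sepAut σ l) :=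
  rfl

theorem sepAut_one (l : SeparableCenter k w) :
    sepAut (1 : Subring.center (Residue w) ≃ₐ[k] Subring.center (Residue w)) l = l :=
  rfl

variable (k w) in
/-- The inclusion of the separable closure in the residue division ring. -/
noncomputable def sepVal : SeparableCenter k w →ₐ[k] Residue w :=
  (centerVal w k).comp (separableClosure k (Subring.center (Residue w))).val

@[simp]
theorem sepVal_apply (l : SeparableCenter k w) :
    sepVal k w l = ((l : Subring.center (Residue w)) : Residue w) :=
  rfl

theorem sepVal_injective : Function.Injective (sepVal k w) :=
  Subtype.val_injective.comp Subtype.val_injective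

theorem unitConj_zpow_lift {s : SeparableCenter k w →ₐ[k] w.integer} {z : Dˣ}
    (h : ∀ l, unitConj w z (s l) = s (sepAut (centerAut k w z) l)) (m : ℤ)
    (l : SeparableCenter k w) :
    unitConj w (z ^ m) (s l) = s (sepAut (centerAut k w z ^ m) l) := by
  -- Phrasing the condition as a subgroup covers negative exponents.
  let H : Subgroup Dˣ :=
    { carrier := {y | ∀ l, unitConj w y (s l) = s (sepAut (centerAut k w y) l)}
      one_mem' := fun l => by rw [unitConj_one, map_one, sepAut_one]
      mul_mem' := fun {a b} ha hb l => by rw [unitConj_mul, hb, ha, map_mul, sepAut_mul]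
      inv_mem' := fun {a} ha l => by
        rw [← unitConj_one w (s (sepAut _ l)), ← inv_mul_cancel a, unitConj_mul, ha, ← sepAut_mul,
          ← map_mul, mul_inv_cancel, map_one, sepAut_one] }
  have hz : z ^ m ∈ H := H.zpow_mem h m
  rw [← map_zpow]
  exact hz l

variable [FiniteDimensional (LaurentSeries k) D]

instance finite_separableCenter : FiniteDimensional k (SeparableCenter k w) :=
  have := finite_center (k := k) (w := w)
  inferInstance

variable (k w) in
/-- A generator of the separable closure, with its power basis. -/
noncomputable def sepBasis : PowerBasis k (SeparableCenter k w) :=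
  Field.powerBasisOfFiniteOfSeparable k (SeparableCenter k w)

theorem sepVal_derivative_ne_zero :
    aeval (sepVal k w (sepBasis k w).gen) (derivative (minpoly k (sepBasis k w).gen)) ≠ 0 := by
  rw [aeval_algHom_apply, map_ne_zero_iff _ sepVal_injective]
  exact (Algebra.IsSeparable.isSeparable k (sepBasis k w).gen).aeval_derivative_ne_zero
    (minpoly.aeval _ _)

/-- An automorphism of the center is determined by its value at the generator of the separable
closure. -/
theorem aut_ext_gen {τ σ : Subring.center (Residue w) ≃ₐ[k] Subring.center (Residue w)}
    (h : τ (sepBasis k w).gen = σ (sepBasis k w).gen) : τ = σ := by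
  have := finite_center (k := k) (w := w)
  have h1 : (sepAut τ).toAlgHom = (sepAut σ).toAlgHom :=
    (sepBasis k w).algHom_ext (Subtype.ext h)
  have h2 : (τ : Subring.center (Residue w) →+* Subring.center (Residue w)) = σ := by
    -- The center is purely inseparable over the separable closure, so embeddings extend uniquely.
    apply IsPurelyInseparable.injective_comp_algebraMap (SeparableCenter k w)
    ext l : 1
    exact congrArg Subtype.val (DFunLike.congr_fun h1 l)
  exact AlgEquiv.ext fun a => DFunLike.congr_fun h2 a

/-- The separable closure of the coefficient field in the center of the residue division ring
lifts to the centralizer of a given section. -/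
theorem exists_lift (u : ResidueSection w) :
    ∃ s : SeparableCenter k w →ₐ[k] w.integer,
      (∀ l, residue w (s l) = sepVal k w l) ∧ ∀ l a, Commute (u.toHom a) (s l) := by
  set pb := sepBasis k w with hpb
  have hres : ∀ g : k[X], residue w (aeval (u.toHom (sepVal k w pb.gen)) g)
      = aeval (sepVal k w pb.gen) g := fun g => by
    rw [← residueAlgHom_apply (k := k), ← aeval_algHom_apply, residueAlgHom_apply, u.residue_toHom]
  obtain ⟨c, hc, hca, hcomm⟩ := exists_root_of_residue (f := minpoly k pb.gen)
    (minpoly.monic (Algebra.IsIntegral.isIntegral _)) (u.toHom (sepVal k w pb.gen))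
    (by rw [hres, aeval_algHom_apply, minpoly.aeval, map_zero])
    (by rw [hres]; exact sepVal_derivative_ne_zero)
  refine ⟨pb.lift c hc, fun l => ?_, fun l a => ?_⟩
  · have : (residueAlgHom w k).comp (pb.lift c hc) = sepVal k w :=
      pb.algHom_ext (by simp [hca, u.residue_toHom])
    exact DFunLike.congr_fun this l
  · have hle : (⊤ : Subalgebra k (SeparableCenter k w))
        ≤ (Subalgebra.centralizer k {u.toHom a}).comap (pb.lift c hc) := by
      rw [← pb.adjoin_gen_eq_top]
      refine Algebra.adjoin_le ?_
      rintro _ rfl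
      rw [SetLike.mem_coe, Subalgebra.mem_comap, Subalgebra.mem_centralizer_iff, pb.lift_gen]
      rintro _ rfl
      -- The generator is central in the residue ring, so its image under `u` commutes with `u(a)`;
      -- the Hensel root inherits this.
      refine Subtype.ext (hcomm _ ?_)
      have : u.toHom a * u.toHom (sepVal k w pb.gen) = u.toHom (sepVal k w pb.gen) * u.toHom a := by
        rw [← map_mul, ← map_mul, sepVal_apply, Subring.mem_center_iff.1 pb.gen.1.2]
      exact congrArg Subtype.val this
    exact Subalgebra.mem_centralizer_iff k |>.1 (hle (Algebra.mem_top (x := l))) _ rfl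

/-- Conjugation by a parameter generates the Galois group of the center of the residue division
ring. -/
theorem mem_zpowers_centerAut [Algebra.IsCentral (LaurentSeries k) D] (u : ResidueSection w)
    {z : Dˣ} (hz : IsParameter w (z : D))
    (τ : Subring.center (Residue w) ≃ₐ[k] Subring.center (Residue w)) :
    τ ∈ Subgroup.zpowers (centerAut k w z) := by
  obtain ⟨s, hs, -⟩ := exists_lift (k := k) u
  set pb := sepBasis k w with hpb
  set f := minpoly k pb.gen with hf
  have hmonic : f.Monic := minpoly.monic (Algebra.IsIntegral.isIntegral _)
  let ι : k →+* LaurentSeries k := (algebraMap (PowerSeries k) (LaurentSeries k)).comp PowerSeries.C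
  have hroot : ∀ l : SeparableCenter k w, aeval l f = 0 → aeval (s l : D) (f.map ι) = 0 := by
    intro l hl
    have h1 : aeval (s l) f = 0 := by rw [aeval_algHom_apply, hl, map_zero]
    have h2 := congrArg w.integer.subtype h1
    rw [map_zero, aeval_def, hom_eval₂] at h2
    rw [aeval_def, eval₂_map]
    exact h2
  have hdeg : (f.map ι).natDegree = f.natDegree := natDegree_map ι
  have hli : LinearIndependent (LaurentSeries k)
      fun i : Fin (f.map ι).natDegree => (s pb.gen : D) ^ (i : ℕ) := by
    rw [hdeg]
    have := linearIndependent_of_residue (k := k) (w := w)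
      (y := fun i : Fin f.natDegree => s pb.gen ^ (i : ℕ)) (by
        simp only [← map_pow, hs]
        exact (linearIndependent_pow pb.gen).map' (sepVal k w).toLinearMap
          (LinearMap.ker_eq_bot.2 sepVal_injective))
    exact this
  -- The lifts of `θ` and `τ θ` are roots of the same polynomial over the center, hence conjugate by
  -- some `x`. Up to an element of value 1, `x` is a power `z ^ i`, so `τ` is the `i`-th power of
  -- the action of `z`.
  obtain ⟨x, hx0, hx⟩ := exists_mul_eq_mul_of_aeval_eq_zero (hmonic.map ι)
    (by rw [hdeg]; exact minpoly.natDegree_pos (Algebra.IsIntegral.isIntegral _))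
    (hroot (sepAut τ pb.gen)
      (by rw [aeval_algHom_apply (sepAut τ), minpoly.aeval, map_zero]))
    (hroot pb.gen (minpoly.aeval _ _)) hli
  obtain ⟨i, hi⟩ := hz.generates x hx0
  have hzi : w ((z : D) ^ i) ≠ 0 := by
    rw [map_zpow₀]; exact zpow_ne_zero _ (w.ne_zero_iff.2 hz.ne_zero)
  let y : Dˣ := Units.mk0 x hx0
  have hconj : unitConj w y (s pb.gen) = s (sepAut τ pb.gen) := by
    apply Subtype.ext
    rw [coe_unitConj, Units.mul_inv_eq_iff_eq_mul]
    exact hx.symm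
  have hy : y = (y * (z ^ i)⁻¹) * z ^ i := by simp
  have hv : w ((y * (z ^ i)⁻¹ : Dˣ) : D) = 1 := by
    rw [Units.val_mul, map_mul, Units.val_inv_eq_inv_val, map_inv₀, Units.val_zpow_eq_zpow_val]
    change w x * _ = 1
    rw [hi, map_zpow₀] at *
    exact mul_inv_cancel₀ hzi
  refine ⟨i, ?_⟩
  change centerAut k w z ^ i = τ
  have h1 : centerAut k w y = centerAut k w z ^ i := by
    rw [hy, map_mul, centerAut_eq_one w hv, one_mul, map_zpow]
  rw [← h1]
  refine aut_ext_gen (Subtype.ext ?_)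
  have h2 := congrArg (residue w) hconj
  rw [← residueConj_residue, hs, hs] at h2
  exact h2

/-- The order of the Galois group is the order of conjugation by a parameter. -/
theorem galOrder_eq_orderOf [Algebra.IsCentral (LaurentSeries k) D] (u : ResidueSection w)
    {z : Dˣ} (hz : IsParameter w (z : D)) : galOrder w = orderOf (centerAut k w z) := by
  rw [galOrder_eq_card (k := k)]
  exact (orderOf_eq_card_of_forall_mem_zpowers (mem_zpowers_centerAut u hz)).symm

/-- There is a parameter acting by conjugation on the lift of the separable closure. -/
theorem exists_parameter_unitConj_lift (s : SeparableCenter k w →ₐ[k] w.integer)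
    (hs : ∀ l, residue w (s l) = sepVal k w l) :
    ∃ z : Dˣ, IsParameter w (z : D) ∧
      ∀ l, unitConj w z (s l) = s (sepAut (centerAut k w z) l) := by
  obtain ⟨z₀, hz₀⟩ := exists_isParameter w k
  let z : Dˣ := Units.mk0 z₀ hz₀.ne_zero
  set pb := sepBasis k w with hpb
  set f := minpoly k pb.gen with hf
  let κ : Dˣ → w.integer →ₐ[k] w.integer := fun y =>
    { unitConj w y with commutes' := unitConj_algebraMap w y }
  have hκ : ∀ y l, κ y l = unitConj w y l := fun _ _ => rfl
  have hres : residueAlgHom w k (s (sepAut (centerAut k w z) pb.gen))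
      = residueAlgHom w k (κ z (s pb.gen)) := by
    rw [residueAlgHom_apply, residueAlgHom_apply, hs, hκ, ← residueConj_residue, hs]
    rfl
  -- Both `s(α θ)` and `z s(θ) z⁻¹` are roots of `f` with the same residue, so `x` intertwines them.
  -- Its residue is a value of `f'`, nonzero by separability, so `x` is a unit and `x z` is again a
  -- parameter with the same action on the center.
  obtain ⟨x, hx, hx'⟩ := exists_mul_sub_mul_eq_aeval_sub (residueAlgHom w k) hres f
  have h0 : aeval pb.gen f = 0 := minpoly.aeval _ _
  rw [aeval_algHom_apply s, aeval_algHom_apply (sepAut (centerAut k w z)), aeval_algHom_apply (κ z),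
    aeval_algHom_apply s, h0, map_zero, map_zero, map_zero, sub_zero, sub_eq_zero] at hx
  have hxne : residue w x ≠ 0 := by
    rw [residueAlgHom_apply] at hx'
    rw [hx', ← hres, residueAlgHom_apply, hs, aeval_algHom_apply,
      aeval_algHom_apply (sepAut (centerAut k w z)), map_ne_zero_iff _ sepVal_injective,
      map_ne_zero_iff _ (sepAut (centerAut k w z)).injective]
    intro h
    apply sepVal_derivative_ne_zero (k := k) (w := w)
    rw [aeval_algHom_apply]
    exact (congrArg _ h).trans (map_zero _)
  have hx1 := (residue_ne_zero_iff x).1 hxne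
  let v : Dˣ := Units.mk0 x (w.ne_zero_iff.1 (by rw [hx1]; exact one_ne_zero))
  have hw : w ((v * z : Dˣ) : D) = w z₀ := by
    change w ((x : D) * z₀) = _
    rw [map_mul, hx1, one_mul]
  have hα : centerAut k w (v * z) = centerAut k w z := by
    rw [map_mul, centerAut_eq_one w hx1, one_mul]
  refine ⟨v * z, ⟨Units.ne_zero _, by rw [hw]; exact hz₀.lt_one, by rw [hw]; exact hz₀.generates⟩,
    fun l => ?_⟩
  rw [hα]
  have : (κ (v * z)).comp s = s.comp (sepAut (centerAut k w z)).toAlgHom := by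
    refine pb.algHom_ext ?_
    change unitConj w (v * z) (s pb.gen) = s (sepAut (centerAut k w z) pb.gen)
    rw [unitConj_mul]
    apply Subtype.ext
    rw [coe_unitConj, Units.mul_inv_eq_iff_eq_mul]
    exact (congrArg Subtype.val hx).symm
  exact DFunLike.congr_fun this l

/-- The expansion of an element that commutes with the lift of the separable closure involves
only powers of the parameter with exponents divisible by the order of the Galois group. -/
theorem coeff_eq_zero_of_commute [Algebra.IsCentral (LaurentSeries k) D] {u : ResidueSection w}
    {s : SeparableCenter k w →ₐ[k] w.integer} (hs : ∀ l, residue w (s l) = sepVal k w l)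
    (hu : ∀ l a, Commute (u.toHom a) (s l)) {z : Dˣ} (hz : IsParameter w (z : D))
    (h : ∀ l, unitConj w z (s l) = s (sepAut (centerAut k w z) l)) {x : w.integer}
    (hx : Commute x (s (sepBasis k w).gen)) {j : ℕ} (hj : ¬ galOrder w ∣ j) :
    coeff hz u j x = 0 := by
  induction j using Nat.strong_induction_on with
  | _ j ih =>
    set θ := (sepBasis k w).gen with hθ
    set α := centerAut k w z with hα
    have hmove : ∀ i : ℕ, (z : D) ^ i * s θ = s (sepAut (α ^ i) θ) * (z : D) ^ i := by
      intro i
      have := congrArg Subtype.val (unitConj_zpow_lift h i θ)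
      rwa [coe_unitConj, Units.mul_inv_eq_iff_eq_mul, zpow_natCast, zpow_natCast,
        Units.val_pow_eq_pow_val] at this
    have hD : ∀ {a b : w.integer}, Commute a b → Commute (a : D) (b : D) :=
      fun hab => congrArg Subtype.val hab
    -- Below `j`, a term either vanishes by induction or has an exponent `i` with `α ^ i = 1`, so
    -- that `z ^ i` commutes with `s θ`. Hence the remainder `T z ^ j` commutes with `s θ` as well.
    have hsum : Commute (∑ i ∈ Finset.range j, (u.toHom (coeff hz u i x) : D) * (z : D) ^ i)
        (s θ : D) := by
      refine Commute.sum_left _ _ _ fun i hi => ?_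
      by_cases hdvd : galOrder w ∣ i
      · refine (hD (hu θ _)).mul_left ?_
        rw [galOrder_eq_orderOf (k := k) u hz] at hdvd
        have := hmove i
        rwa [orderOf_dvd_iff_pow_eq_one.1 hdvd, sepAut_one] at this
      · rw [ih i (Finset.mem_range.1 hi) hdvd, map_zero, ZeroMemClass.coe_zero, zero_mul]
        exact Commute.zero_left _
    set T := (tail hz u)^[j] x with hT
    have hTz : Commute ((T : D) * (z : D) ^ j) (s θ : D) := by
      have := (hD hx).sub_left hsum
      rwa [sub_eq_iff_eq_add'.2 (expansion hz u x j)] at this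
    have hTs : T * s (sepAut (α ^ j) θ) = s θ * T := by
      apply Subtype.ext
      apply mul_right_cancel₀ (pow_ne_zero j hz.ne_zero)
      have := hTz.eq
      rw [mul_assoc, hmove, ← mul_assoc, ← mul_assoc] at this
      exact this
    -- As `θ` is central, the residues give `c_j (α ^ j θ - θ) = 0` in a division ring, where `c_j`
    -- is the residue of `T`.
    have hres := congrArg (residue w) hTs
    rw [map_mul, map_mul, hs, hs, sepVal_apply θ,
      ← Subring.mem_center_iff.1 (θ : Subring.center (Residue w)).2, ← sepVal_apply,
      ← sub_eq_zero, ← mul_sub, ← map_sub] at hres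
    refine (mul_eq_zero.1 hres).resolve_right fun h0 => hj ?_
    rw [map_eq_zero_iff _ sepVal_injective, sub_eq_zero] at h0
    rw [galOrder_eq_orderOf (k := k) u hz]
    exact orderOf_dvd_of_pow_eq_one (aut_ext_gen (congrArg Subtype.val h0))

end

end DeltaMaps

theorem mainTheorem8 {k : Type*} [Field k] {D : Type*} [DivisionRing D]
    [Algebra (LaurentSeries k) D] [Algebra.IsCentral (LaurentSeries k) D]
    [FiniteDimensional (LaurentSeries k) D]
    {Γ₀ : Type*} [LinearOrderedCommGroupWithZero Γ₀] (w : Valuation D Γ₀)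
    [Valuation.HasExtension (Valued.v : Valuation (LaurentSeries k) (WithZero (Multiplicative ℤ))) w]
    (u : DeltaMaps.ResidueSection w) :
    ∃ (z' : D) (hz' : DeltaMaps.IsParameter w z'),
      ∀ (m : ℤ) (j : ℕ), ¬ DeltaMaps.galOrder w ∣ j →
        ∀ a : DeltaMaps.Residue w, DeltaMaps.deltaMap hz' u m j a = 0 := by
  obtain ⟨s, hs, hu⟩ := DeltaMaps.exists_lift (k := k) u
  obtain ⟨z, hz, h⟩ := DeltaMaps.exists_parameter_unitConj_lift s hs
  refine ⟨z, hz, fun m j hj a => DeltaMaps.coeff_eq_zero_of_commute hs hu hz h ?_ hj⟩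
  have hconj : DeltaMaps.conj hz u m a = DeltaMaps.unitConj w (z ^ m) (u.toHom a) :=
    Subtype.ext (by simp [DeltaMaps.conj, DeltaMaps.coe_unitConj])
  -- Conjugation by `z ^ m` preserves the lift, so the required commutation is the conjugate of that
  -- between `u a` and `s (α ^ (-m) θ)`.
  have hgen : s (DeltaMaps.sepBasis k w).gen = DeltaMaps.unitConj w (z ^ m)
      (s (DeltaMaps.sepAut (DeltaMaps.centerAut k w z ^ (-m)) (DeltaMaps.sepBasis k w).gen)) := by
    rw [DeltaMaps.unitConj_zpow_lift h, ← DeltaMaps.sepAut_mul, ← zpow_add, add_neg_cancel,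
      zpow_zero, DeltaMaps.sepAut_one]
  rw [hconj, hgen]
  exact (hu _ a).map (DeltaMaps.unitConj w (z ^ m))
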